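/- Let $\beta$ be a Pisot number, that is, a real algebraic integer $\beta>1$ all of whose Galois conjugates other than $\beta$ itself have modulus less than one. Let $\lambda$ be the Lebesgue measure on $[0,1]$ and let $T:[0,1]\to[0,1]$, $T(x)=\{\beta x\}$ (fractional part). Let $[0,1]=\bigcup_{i=1}^{\ell}J_i$ be a finite partition into intervals (open, closed, half-open or single points), and let $S:[0,1]\to[0,1]$ be a map with $S(x)=\epsilon_i\beta^{m_i}x+b_i$ for $x\in J_i$, where $\epsilon_i\in\{-1,1\}$, $m_i\ge 1$ is an integer and $b_i\in\mathbb{Q}(\beta)$ for $1\le i\le\ell$. Suppose that $S$ preserves a Borel probability measure $\nu$ on $[0,1]$ which is ergodic and for which there is a constant $c>0$ with $$c^{-1}\lambda(E)\le\nu(E)\le c\,\lambda(E)\qquad\text{for every Borel set }E\subset[0,1].$$ Then $T$ has a unique invariant Borel probability measure $\mu_\beta$ that is absolutely continuous with respect to $\lambda$; this measure is ergodic; and $T$ and $S$ have the same generic points: for every $x\in[0,1]$, one has $$\lim_{N\to\infty}\frac1N\sum_{n=0}^{N-1}f(T^nx)=\int_{[0,1]} f\,d\mu_\beta\quad\text{for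 all continuous } f:[0,1]\to\mathbb{R}$$ if and only if $$\lim_{N\to\infty}\frac1N\sum_{n=0}^{N-1}f(S^nx)=\int_{[0,1]} f\,d\nu\quad\text{for all continuous } f:[0,1]\to\mathbb{R}.$$ -/

import Mathlib

open MeasureTheory Filter Topology

/-- A Pisot number: a real algebraic integer greater than one all of whose Galois conjugates
(the complex roots of its minimal polynomial over `ℚ`), except itself, have modulus less
than one. -/
def IsPisot (β : ℝ) : Prop :=
  1 < β ∧ IsIntegral ℤ β ∧
    ∀ z : ℂ, Polynomial.aeval z (minpoly ℚ β) = 0 → z ≠ (β : ℂ) → ‖z‖ < 1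

/-- The map `x ↦ {β x}` (fractional part) of the closed unit interval `[0, 1]` into itself. -/
noncomputable def betaMap (β : ℝ) (x : unitInterval) : unitInterval :=
  ⟨Int.fract (β * (x : ℝ)), Int.fract_nonneg _, (Int.fract_lt_one _).le⟩

/-- The set of generic points of `(X, μ, T)`: the points `x` such that, for every continuous
`f : X → ℝ`, the averages `(1 / N) ∑_{n < N} f (T^n x)` converge to `∫ f dμ`. -/
def dynGenericPoints {X : Type*} [TopologicalSpace X] [MeasurableSpace X]
    (T : X → X) (μ : Measure X) : Set X :=
  {x | ∀ f : C(X, ℝ),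
    Tendsto (fun N : ℕ => birkhoffAverage ℝ T (fun y => f y) N x) atTop (𝓝 (∫ y, f y ∂μ))}

/-! Run the two maps in parallel from the same point `x`, letting `T` make `m i` steps while `S`
makes one on the branch `i`. If `n_k` is the sum of the exponents met in `k` steps of `S`, then both
`T^{n_k} x` and `S^k x` are `± β^{n_k} x` plus an element of `ℚ(β)`, so `T^{n_k} x = ± S^k x + d_k`
with `d_k ∈ ℚ(β)`. These `d_k` have a common denominator, lie in `[-1, 2]`, and their other
conjugates stay bounded because the conjugates of `β` contract. Hence they take finitely many values
(`IsPisot.exists_finite_difference`).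

So each orbit is carried into the other by finitely many relations that distort Lebesgue measure by
a bounded factor. If `x` is generic for one map, whose measure has bounded density, then every weak
limit of the empirical measures of the other orbit is absolutely continuous
(`absolutelyContinuous_of_relations`). Such a limit does not charge the discontinuities, hence is
invariant, hence equals the ergodic measure; compactness gives genericity
(`mem_dynGenericPoints_of_forall_absolutelyContinuous`).

For `T` itself, Parry's series gives an invariant measure with density bounded above and below. The
same finiteness argument shows that the orbit of `1` is finite, so the images `[0, T^k 1)` of
cylinders have lengths bounded below. By Lebesgue density an invariant set of positive measure then
fills a fixed `[0, δ)`, which a set and its complement cannot both do: `T` is ergodic, and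
uniqueness follows. -/

/-! ### Empirical measures -/

section Empirical

variable {X : Type*} [MeasurableSpace X]

/-- The empirical measure of the first `N + 1` terms of a sequence. -/
noncomputable def empiricalMeasure (u : ℕ → X) (N : ℕ) : ProbabilityMeasure X :=
  ⟨((N + 1 : ℕ) : ENNReal)⁻¹ • ∑ n ∈ Finset.range (N + 1), Measure.dirac (u n), ⟨by
    simp only [Measure.smul_apply, Measure.finsetSum_apply, measure_univ, Finset.sum_const,
      Finset.card_range, smul_eq_mul, nsmul_eq_mul, mul_one]
    exact ENNReal.inv_mul_cancel (by simp) (ENNReal.natCast_ne_top _)⟩⟩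

open Classical in
theorem empiricalMeasure_apply [MeasurableSingletonClass X] (u : ℕ → X) (N : ℕ) (E : Set X) :
    (empiricalMeasure u N : Measure X) E =
      ((N + 1 : ℕ) : ENNReal)⁻¹ * ((Finset.range (N + 1)).filter (fun n => u n ∈ E)).card := by
  simp [empiricalMeasure, Set.indicator_apply]

theorem integral_empiricalMeasure [MeasurableSingletonClass X] (u : ℕ → X) (N : ℕ) (f : X → ℝ) :
    ∫ x, f x ∂(empiricalMeasure u N : Measure X) =
      ((N + 1 : ℕ) : ℝ)⁻¹ * ∑ n ∈ Finset.range (N + 1), f (u n) := by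
  simp only [empiricalMeasure, ProbabilityMeasure.coe_mk]
  rw [integral_smul_measure, integral_finsetSum_measure]
  · rw [ENNReal.toReal_inv, ENNReal.toReal_natCast, smul_eq_mul]
    simp only [integral_dirac]
  · intro i _
    exact integrable_dirac (by simp)

theorem integral_empiricalMeasure_orbit [MeasurableSingletonClass X] (T : X → X) (x : X) (N : ℕ)
    (f : X → ℝ) :
    ∫ y, f y ∂(empiricalMeasure (fun n => T^[n] x) N : Measure X) =
      birkhoffAverage ℝ T f (N + 1) x := by
  rw [integral_empiricalMeasure, birkhoffAverage, birkhoffSum, smul_eq_mul]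

end Empirical

/-! ### Generic points and weak limits of empirical measures -/

section Generic

variable {X : Type*} [MetricSpace X] [CompactSpace X] [MeasurableSpace X] [BorelSpace X]

/-- Turns genericity into convergence in the compact space of probability measures. Empirical
measures use `N + 1` terms so as to have mass one for every `N`; the shift does not affect the
limit. -/
theorem mem_dynGenericPoints_iff_tendsto (T : X → X) (μ : ProbabilityMeasure X) (x : X) :
    x ∈ dynGenericPoints T (μ : Measure X) ↔
      Tendsto (empiricalMeasure fun n => T^[n] x) atTop (𝓝 μ) := by
  rw [ProbabilityMeasure.tendsto_iff_forall_integral_tendsto]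
  simp only [integral_empiricalMeasure_orbit]
  constructor
  · intro h f
    have := h f.toContinuousMap
    exact (tendsto_add_atTop_iff_nat 1).2 this
  · intro h f
    exact (tendsto_add_atTop_iff_nat 1).1 (h (BoundedContinuousFunction.mkOfCompact f))

/-- A subsequential weak limit of the empirical measures along an orbit is invariant if it does not
charge the discontinuities of the map. -/
theorem measurePreserving_of_tendsto_empiricalMeasure {T : X → X} (hT : Measurable T) {x : X}
    {ρ : ProbabilityMeasure X} (hc : ∀ᵐ y ∂(ρ : Measure X), ContinuousAt T y) {σ : ℕ → ℕ}
    (hσ : Tendsto σ atTop atTop)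
    (h : Tendsto (fun k => empiricalMeasure (fun n => T^[n] x) (σ k)) atTop (𝓝 ρ)) :
    MeasurePreserving T (ρ : Measure X) (ρ : Measure X) := by
  refine ⟨hT, ?_⟩
  -- Starting at `T x` instead of `x` changes a Birkhoff average of a bounded function by `O(1 /
  -- N)`.
  have h1 : Tendsto (fun k => empiricalMeasure (fun n => T^[n] (T x)) (σ k)) atTop (𝓝 ρ) := by
    rw [ProbabilityMeasure.tendsto_iff_forall_integral_tendsto] at h ⊢
    intro f
    have h2 := h f
    simp only [integral_empiricalMeasure_orbit] at h2 ⊢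
    have h3 := tendsto_birkhoffAverage_apply_sub_birkhoffAverage' ℝ (g := f)
      f.isBounded_range T x
    have h4 := (h3.comp ((tendsto_add_atTop_nat 1).comp hσ)).add h2
    simpa using h4
  have h2 : Tendsto (fun k => empiricalMeasure (fun n => T^[n] (T x)) (σ k)) atTop
      (𝓝 (ρ.map hT.aemeasurable)) := by
    refine tendsto_of_forall_isOpen_le_liminf' fun G hG => ?_
    rw [ProbabilityMeasure.toMeasure_map, Measure.map_apply hT hG.measurableSet]
    -- At a continuity point in `T ⁻¹' G` this set is a neighbourhood, so it is `ρ`-almost all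
    -- interior and the portmanteau inequality for open sets applies.
    have h3 : (ρ : Measure X) (T ⁻¹' G) ≤ (ρ : Measure X) (interior (T ⁻¹' G)) := by
      refine measure_mono_ae ?_
      filter_upwards [hc] with y hy hyG
      exact mem_interior_iff_mem_nhds.2 (hy (hG.mem_nhds hyG))
    refine (h3.trans (ProbabilityMeasure.le_liminf_measure_open_of_tendsto h
      isOpen_interior)).trans (liminf_le_liminf (Eventually.of_forall fun k => ?_))
    refine (measure_mono interior_subset).trans_eq ?_
    classical
    rw [empiricalMeasure_apply, empiricalMeasure_apply]
    refine congrArg _ (congrArg _ (congrArg _ (Finset.filter_congr fun n _ => ?_)))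
    rw [Set.mem_preimage, ← Function.iterate_succ_apply' T, Function.iterate_succ_apply]
  have h3 := tendsto_nhds_unique h2 h1
  rw [← ProbabilityMeasure.toMeasure_map _ hT.aemeasurable, h3]

/-- If every subsequential weak limit of the empirical measures along the orbit of `x` is
absolutely continuous, then `x` is generic for the absolutely continuous ergodic measure. -/
theorem mem_dynGenericPoints_of_forall_absolutelyContinuous {T : X → X} (hT : Measurable T)
    {vol μ : Measure X} [IsProbabilityMeasure μ] (hμ : Ergodic T μ) (hvol : vol ≪ μ)
    (hc : ∀ᵐ y ∂vol, ContinuousAt T y) {x : X}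
    (hx : ∀ (ρ : ProbabilityMeasure X) (σ : ℕ → ℕ), Tendsto σ atTop atTop →
      Tendsto (fun k => empiricalMeasure (fun n => T^[n] x) (σ k)) atTop (𝓝 ρ) →
      (ρ : Measure X) ≪ vol) :
    x ∈ dynGenericPoints T μ := by
  refine (mem_dynGenericPoints_iff_tendsto T ⟨μ, inferInstance⟩ x).2 ?_
  refine tendsto_of_subseq_tendsto fun ns hns => ?_
  obtain ⟨ρ, φ, hφ, hlim⟩ := CompactSpace.tendsto_subseq
    (fun k => empiricalMeasure (fun n => T^[n] x) (ns k))
  have hρ := hx ρ (ns ∘ φ) (hns.comp hφ.tendsto_atTop) hlim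
  have hinv := measurePreserving_of_tendsto_empiricalMeasure hT (hρ.ae_le hc)
    (hns.comp hφ.tendsto_atTop) hlim
  have heq := hμ.eq_of_absolutelyContinuous hinv (hρ.trans hvol)
  refine ⟨φ, ?_⟩
  have : (⟨μ, inferInstance⟩ : ProbabilityMeasure X) = ρ := Subtype.ext heq.symm
  rw [this]
  exact hlim

/-- A finite measure bounded by a multiple of `vol` on open sets with null frontier is
absolutely continuous. -/
theorem absolutelyContinuous_of_forall_null_frontier_le {ρ vol : Measure X} [IsFiniteMeasure ρ]
    [IsFiniteMeasure vol] {D : ENNReal} (hD : D ≠ ⊤)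
    (h : ∀ G, IsOpen G → vol (frontier G) = 0 → ρ G ≤ D * vol G) : ρ ≪ vol := by
  refine Measure.AbsolutelyContinuous.mk fun A hA h0 => ?_
  -- Inner regularity reduces to closed null sets, which are limits of open thickenings with null
  -- frontier and volume tending to zero.
  rw [hA.measure_eq_iSup_isClosed_of_ne_top (measure_ne_top _ _)]
  simp only [ENNReal.iSup_eq_zero]
  intro F hFA hF
  have hF0 : vol F = 0 := measure_mono_null hFA h0
  obtain ⟨rs, hrs, hrs'⟩ := exists_null_frontiers_thickening vol F
  have h1 : Tendsto rs atTop (𝓝[>] 0) :=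
    tendsto_nhdsWithin_iff.2 ⟨hrs, Eventually.of_forall fun n => (hrs' n).1⟩
  have h2 := (tendsto_measure_thickening_of_isClosed (μ := vol)
    ⟨1, one_pos, measure_ne_top _ _⟩ hF).comp h1
  rw [hF0] at h2
  have h3 := ENNReal.Tendsto.const_mul (a := D) h2 (Or.inr hD)
  rw [mul_zero] at h3
  refine le_antisymm (ge_of_tendsto' h3 fun n => ?_) (zero_le)
  exact (measure_mono (Metric.self_subset_thickening (hrs' n).1 F)).trans
    (h _ Metric.isOpen_thickening (hrs' n).2)

open Classical in
/-- Counting estimate behind `absolutelyContinuous_of_relations`. -/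
theorem empiricalMeasure_le_sum_of_relations {ι : Type*} [Fintype ι] {u v : ℕ → X}
    {E : Set X} {E' : ι → Set X} {lab : ℕ → ι} {κ : ℕ → ℕ} {Q : ℕ} (hQ : 1 ≤ Q)
    (hκ : ∀ n, κ n ≤ Q * n) (hinj : ∀ n n', lab n = lab n' → κ n = κ n' → n = n')
    (hrel : ∀ n, u n ∈ E → v (κ n) ∈ E' (lab n)) (N : ℕ) :
    (empiricalMeasure u N : Measure X) E ≤
      Q * ∑ r, (empiricalMeasure v (Q * N) : Measure X) (E' r) := by
  simp only [empiricalMeasure_apply]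
  have hcard : ((Finset.range (N + 1)).filter (fun n => u n ∈ E)).card ≤
      ∑ r, ((Finset.range (Q * N + 1)).filter (fun n => v n ∈ E' r)).card := by
    rw [← Finset.card_sigma]
    -- The visits of `u` to `E` inject into labelled visits of `v`, the time being recovered from
    -- the label and `κ n`.
    refine Finset.card_le_card_of_injOn (fun n => ⟨lab n, κ n⟩) ?_ ?_
    · intro n hn
      simp only [Finset.coe_filter, Finset.mem_range, Set.mem_ofPred_eq] at hn
      simp only [Finset.coe_sigma, Set.mem_sigma_iff, Finset.mem_coe, Finset.mem_univ,
        Finset.mem_filter, Finset.mem_range, true_and]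
      refine ⟨?_, hrel n hn.2⟩
      have := hκ n
      have : Q * n ≤ Q * N := Nat.mul_le_mul_left _ (by omega)
      omega
    · intro n _ n' _ h
      simp only [Sigma.mk.injEq, heq_eq_eq] at h
      exact hinj n n' h.1 h.2
  rw [← Finset.mul_sum, ← mul_assoc]
  refine mul_le_mul' ?_ (by exact_mod_cast hcard)
  -- The normalizations compare because `Q * N + 1 ≤ Q * (N + 1)`.
  rw [← div_eq_mul_inv, ENNReal.le_div_iff_mul_le (by simp) (by simp),
    mul_comm, ← div_eq_mul_inv]
  refine ENNReal.div_le_of_le_mul ?_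
  norm_cast
  nlinarith

/-- If each term of `u` is related, through finitely many relations that do not increase volume by
more than a constant factor, to a term of a sequence `v` that is equidistributed with
respect to a measure of bounded density, with index map of bounded growth and injective on each
relation, then every subsequential weak limit of the empirical measures of `u` is absolutely
continuous. -/
theorem absolutelyContinuous_of_relations {ι : Type*} [Fintype ι] {vol : Measure X}
    [IsFiniteMeasure vol] {ν : ProbabilityMeasure X} {c C : ENNReal} (hc : c ≠ ⊤) (hC : C ≠ ⊤)
    (hν : ∀ E, (ν : Measure X) E ≤ c * vol E) {u v : ℕ → X}
    (hv : Tendsto (empiricalMeasure v) atTop (𝓝 ν)) (Φ : ι → Set X → Set X)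
    (hfr : ∀ r E, vol (frontier E) = 0 → vol (frontier (Φ r E)) = 0)
    (hΦ : ∀ r E, MeasurableSet E → vol (Φ r E) ≤ C * vol E) {lab : ℕ → ι} {κ : ℕ → ℕ} {Q : ℕ}
    (hQ : 1 ≤ Q) (hκ : ∀ n, κ n ≤ Q * n)
    (hinj : ∀ n n', lab n = lab n' → κ n = κ n' → n = n')
    (hrel : ∀ n E, u n ∈ E → v (κ n) ∈ Φ (lab n) E) {ρ : ProbabilityMeasure X} {σ : ℕ → ℕ}
    (hσ : Tendsto σ atTop atTop)
    (hρ : Tendsto (fun k => empiricalMeasure u (σ k)) atTop (𝓝 ρ)) :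
    (ρ : Measure X) ≪ vol := by
  refine absolutelyContinuous_of_forall_null_frontier_le
    (D := Q * (Fintype.card ι * (c * C))) ?_ fun G hG hG0 => ?_
  · exact ENNReal.mul_ne_top (ENNReal.natCast_ne_top _)
      (ENNReal.mul_ne_top (ENNReal.natCast_ne_top _) (ENNReal.mul_ne_top hc hC))
  have hQσ : Tendsto (fun k => Q * σ k) atTop atTop :=
    tendsto_atTop_mono (fun k => Nat.le_mul_of_pos_left _ hQ) hσ
  have h1 : Tendsto (fun k => (Q : ENNReal) *
      ∑ r, (empiricalMeasure v (Q * σ k) : Measure X) (Φ r G)) atTop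
      (𝓝 (Q * ∑ r, (ν : Measure X) (Φ r G))) := by
    refine ENNReal.Tendsto.const_mul ?_ (Or.inr (ENNReal.natCast_ne_top _))
    refine tendsto_finsetSum _ fun r _ => ?_
    refine ProbabilityMeasure.tendsto_measure_of_null_frontier_of_tendsto' (hv.comp hQσ) ?_
    refine le_antisymm ((hν _).trans ?_) (zero_le)
    rw [hfr r G hG0, mul_zero]
  calc (ρ : Measure X) G
      ≤ atTop.liminf fun k => (empiricalMeasure u (σ k) : Measure X) G :=
        ProbabilityMeasure.le_liminf_measure_open_of_tendsto hρ hG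
    _ ≤ atTop.liminf fun k => (Q : ENNReal) *
          ∑ r, (empiricalMeasure v (Q * σ k) : Measure X) (Φ r G) :=
        liminf_le_liminf (Eventually.of_forall fun k =>
          empiricalMeasure_le_sum_of_relations hQ hκ hinj (fun n => hrel n G) (σ k))
    _ = Q * ∑ r, (ν : Measure X) (Φ r G) := h1.liminf_eq
    _ ≤ Q * ∑ _r : ι, c * (C * vol G) := by
        gcongr with r
        exact (hν _).trans (mul_le_mul_right (hΦ r G hG.measurableSet) c)
    _ = Q * (Fintype.card ι * (c * C)) * vol G := by
        rw [Finset.sum_const, nsmul_eq_mul, Finset.card_univ]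
        ring

end Generic

/-! ### Piecewise affine maps of the unit interval -/

/-- The points `y` of the unit interval such that `s * y + d` lies in `E`. -/
def affinePreimage (s d : ℝ) (E : Set unitInterval) : Set unitInterval :=
  {y | ∃ u ∈ E, (u : ℝ) = s * y + d}

theorem volume_affinePreimage_le {s : ℝ} (hs : s = 1 ∨ s = -1) (d : ℝ) (E : Set unitInterval) :
    volume (affinePreimage s d E) ≤ volume E := by
  have hs0 : s ≠ 0 := by rcases hs with rfl | rfl <;> norm_num
  have hs1 : |s⁻¹| = 1 := by rcases hs with rfl | rfl <;> norm_num
  rw [unitInterval.volume_apply, unitInterval.volume_apply]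
  calc volume (Subtype.val '' affinePreimage s d E)
      ≤ volume ((fun x => s * x) ⁻¹' ((fun x => x + d) ⁻¹' (Subtype.val '' E))) := by
        refine measure_mono ?_
        rintro _ ⟨y, ⟨u, hu, huy⟩, rfl⟩
        exact ⟨u, hu, huy⟩
    _ = volume (Subtype.val '' E) := by
        rw [Real.volume_preimage_mul_left hs0, measure_preimage_add_right, hs1]
        simp

/-- Where `s * y + d` is strictly between `0` and `1`, the set is locally a preimage under a
continuous map; only the two points sent to the ends of the interval can be exceptional. -/
theorem frontier_affinePreimage_subset {s : ℝ} (d : ℝ) (E : Set unitInterval) :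
    frontier (affinePreimage s d E) ⊆
      {y | s * y + d = 0} ∪ {y | s * y + d = 1} ∪ affinePreimage s d (frontier E) := by
  intro y hy
  have hg : Continuous fun z : unitInterval => s * (z : ℝ) + d := by fun_prop
  by_cases h0 : s * y + d = 0
  · exact Or.inl (Or.inl h0)
  by_cases h1 : s * y + d = 1
  · exact Or.inl (Or.inr h1)
  refine Or.inr ?_
  have hcl : s * (y : ℝ) + d ∈ Set.Icc (0 : ℝ) 1 := by
    have : affinePreimage s d E ⊆ (fun z : unitInterval => s * (z : ℝ) + d) ⁻¹' Set.Icc 0 1 := by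
      rintro z ⟨u, _, huz⟩
      simp only [Set.mem_preimage, ← huz]
      exact u.2
    exact closure_minimal this (isClosed_Icc.preimage hg) hy.1
  have hop : ∀ᶠ z : unitInterval in 𝓝 y, s * (z : ℝ) + d ∈ Set.Ioo (0 : ℝ) 1 :=
    hg.continuousAt.eventually_mem (isOpen_Ioo.mem_nhds
      ⟨lt_of_le_of_ne hcl.1 (Ne.symm h0), lt_of_le_of_ne hcl.2 h1⟩)
  let g : unitInterval → unitInterval := fun z => Set.projIcc 0 1 zero_le_one (s * (z : ℝ) + d)
  have hgc : Continuous g := continuous_projIcc.comp hg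
  have hgval : ∀ z : unitInterval, s * (z : ℝ) + d ∈ Set.Ioo (0 : ℝ) 1 →
      (g z : ℝ) = s * (z : ℝ) + d := fun z hz => by
    simp only [g, Set.projIcc_of_mem zero_le_one (Set.Ioo_subset_Icc_self hz)]
  have hEq : ∀ᶠ z in 𝓝 y, z ∈ affinePreimage s d E ↔ z ∈ g ⁻¹' E := by
    filter_upwards [hop] with z hz
    constructor
    · rintro ⟨u, hu, huz⟩
      have : g z = u := Subtype.ext ((hgval z hz).trans huz.symm)
      rw [Set.mem_preimage, this]
      exact hu
    · intro h
      exact ⟨g z, h, hgval z hz⟩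
  refine ⟨g y, ?_, hgval y hop.self_of_nhds⟩
  have hy2 : y ∈ frontier (g ⁻¹' E) := by
    rw [frontier_eq_closure_inter_closure] at hy ⊢
    simp only [Set.mem_inter_iff, mem_closure_iff_frequently] at hy ⊢
    refine ⟨(hy.1.and_eventually hEq).mono fun z hz => hz.2.1 hz.1,
      (hy.2.and_eventually hEq).mono fun z hz h => hz.1 (hz.2.2 h)⟩
  exact hgc.frontier_preimage_subset E hy2

theorem volume_frontier_affinePreimage {s : ℝ} (hs : s = 1 ∨ s = -1) (d : ℝ)
    {E : Set unitInterval} (hE : volume (frontier E) = 0) :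
    volume (frontier (affinePreimage s d E)) = 0 := by
  have hs0 : s ≠ 0 := by rcases hs with rfl | rfl <;> norm_num
  have hsub : ∀ a : ℝ, volume {y : unitInterval | s * y + d = a} = 0 := fun a => by
    refine Set.Subsingleton.measure_zero (fun y hy z hz => Subtype.ext ?_) _
    have : s * (y : ℝ) + d = s * z + d := Eq.trans hy (Eq.symm hz)
    exact mul_left_cancel₀ hs0 (add_right_cancel this)
  refine measure_mono_null (frontier_affinePreimage_subset d E) ?_
  refine measure_union_null (measure_union_null (hsub 0) (hsub 1)) ?_
  exact le_antisymm ((volume_affinePreimage_le hs d _).trans_eq hE) (zero_le)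

/-- Taking preimages under an almost everywhere continuous nonsingular map preserves the class of
sets with null frontier. -/
theorem measure_frontier_preimage {X : Type*} [TopologicalSpace X] [MeasurableSpace X]
    {vol : Measure X} {T : X → X} (hc : ∀ᵐ y ∂vol, ContinuousAt T y)
    (hT : ∀ E, vol E = 0 → vol (T ⁻¹' E) = 0) {E : Set X} (hE : vol (frontier E) = 0) :
    vol (frontier (T ⁻¹' E)) = 0 := by
  refine measure_mono_null (t := {y | ¬ ContinuousAt T y} ∪ T ⁻¹' frontier E) ?_
    (measure_union_null hc (hT _ hE))
  intro y hy
  by_cases hyc : ContinuousAt T y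
  · refine Or.inr ?_
    rw [frontier_eq_closure_inter_closure] at hy
    rw [Set.mem_preimage, frontier_eq_closure_inter_closure]
    exact ⟨hyc.continuousWithinAt.mem_closure hy.1 (fun _ h => h),
      hyc.continuousWithinAt.mem_closure hy.2 (fun _ h => h)⟩
  · exact Or.inl hyc

theorem measure_frontier_iterate_preimage {X : Type*} [TopologicalSpace X] [MeasurableSpace X]
    {vol : Measure X} {T : X → X} (hc : ∀ᵐ y ∂vol, ContinuousAt T y)
    (hT : ∀ E, vol E = 0 → vol (T ⁻¹' E) = 0) {E : Set X} (hE : vol (frontier E) = 0) (n : ℕ) :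
    vol (frontier (T^[n] ⁻¹' E)) = 0 := by
  induction n with
  | zero => simpa using hE
  | succ n ih =>
    rw [Function.iterate_succ, Set.preimage_comp]
    exact measure_frontier_preimage hc hT ih

/-- An interval is a neighbourhood of each of its points except its least and greatest elements, if
any. -/
theorem volume_not_mem_nhds_of_ordConnected {J : Set unitInterval} (hJ : J.OrdConnected) :
    volume {y | y ∈ J ∧ J ∉ 𝓝 y} = 0 := by
  have hsub : {y | y ∈ J ∧ J ∉ 𝓝 y} ⊆ {y | y ∈ J ∧ ∀ z ∈ J, y ≤ z} ∪ {y | y ∈ J ∧ ∀ z ∈ J, z ≤ y} := by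
    rintro y ⟨hy, hn⟩
    by_contra hcon
    simp only [Set.mem_union, Set.mem_ofPred_eq, hy, true_and, not_or, not_forall, not_le] at hcon
    obtain ⟨⟨a, ha, hay⟩, ⟨b, hb, hyb⟩⟩ := hcon
    exact hn (mem_of_superset (Icc_mem_nhds hay hyb) (hJ.out ha hb))
  refine measure_mono_null hsub (measure_union_null ?_ ?_)
  · exact Set.Subsingleton.measure_zero
      (fun y hy z hz => le_antisymm (hy.2 z hz.1) (hz.2 y hy.1)) _
  · exact Set.Subsingleton.measure_zero
      (fun y hy z hz => le_antisymm (hz.2 y hy.1) (hy.2 z hz.1)) _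

theorem ae_continuousAt_of_piecewise_affine {ι : Type*} [Countable ι] {J : ι → Set unitInterval}
    (hJ : ∀ i, (J i).OrdConnected) (hcover : (⋃ i, J i) = Set.univ) {T : unitInterval → unitInterval}
    {a b : ι → ℝ} (hT : ∀ i, ∀ x ∈ J i, (T x : ℝ) = a i * x + b i) :
    ∀ᵐ y : unitInterval, ContinuousAt T y := by
  have h : ∀ᵐ y : unitInterval, ∀ i, ¬ (y ∈ J i ∧ J i ∉ 𝓝 y) :=
    ae_all_iff.2 fun i => by
      rw [ae_iff]
      simpa using volume_not_mem_nhds_of_ordConnected (hJ i)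
  filter_upwards [h] with y hy
  obtain ⟨i, hi⟩ := Set.mem_iUnion.1 (hcover.symm ▸ Set.mem_univ y : y ∈ ⋃ i, J i)
  have hn : J i ∈ 𝓝 y := by
    by_contra hn
    exact hy i ⟨hi, hn⟩
  rw [Topology.IsInducing.subtypeVal.continuousAt_iff]
  have hg : Continuous fun z : unitInterval => a i * (z : ℝ) + b i := by fun_prop
  refine hg.continuousAt.congr ?_
  filter_upwards [hn] with z hz
  exact (hT i z hz).symm

theorem measurable_betaMap (β : ℝ) : Measurable (betaMap β) :=
  Measurable.subtype_mk (measurable_fract.comp (measurable_subtype_coe.const_mul β))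

theorem betaMap_coe (β : ℝ) (x : unitInterval) :
    (betaMap β x : ℝ) = β * x - ⌊β * (x : ℝ)⌋ := rfl

theorem ae_continuousAt_betaMap {β : ℝ} (hβ : 0 ≤ β) :
    ∀ᵐ y : unitInterval, ContinuousAt (betaMap β) y := by
  refine ae_continuousAt_of_piecewise_affine (ι := ℤ)
    (J := fun j => {y : unitInterval | ⌊β * (y : ℝ)⌋ = j}) (a := fun _ => β) (b := fun j => -j)
    ?_ ?_ ?_
  · intro j
    have hm : Monotone fun y : unitInterval => ⌊β * (y : ℝ)⌋ := fun y z hyz =>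
      Int.floor_mono (mul_le_mul_of_nonneg_left hyz hβ)
    exact (Set.ordConnected_singleton (a := j)).preimage_mono hm
  · ext y
    simp
  · intro j x hx
    rw [betaMap_coe, show ⌊β * (x : ℝ)⌋ = j from hx]
    ring

/-! ### Arithmetic of Pisot numbers -/

section Arithmetic

open IntermediateField

variable {β : ℝ}

theorem IsPisot.isIntegral_rat (hβ : IsPisot β) : IsIntegral ℚ β := hβ.2.1.tower_top

theorem IsPisot.isIntegral_gen (hβ : IsPisot β) : IsIntegral ℤ (AdjoinSimple.gen ℚ β) := by
  refine (isIntegral_algHom_iff ((ℚ⟮β⟯).val.restrictScalars ℤ) Subtype.val_injective).1 ?_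
  simpa using hβ.2.1

theorem IsPisot.numberField (hβ : IsPisot β) : NumberField ℚ⟮β⟯ :=
  have := adjoin.finiteDimensional hβ.isIntegral_rat
  { }

theorem IsPisot.norm_embedding_gen_lt (hβ : IsPisot β) (φ : ℚ⟮β⟯ →+* ℂ)
    (hφ : φ (AdjoinSimple.gen ℚ β) ≠ β) : ‖φ (AdjoinSimple.gen ℚ β)‖ < 1 := by
  refine hβ.2.2 _ ?_ hφ
  have h := congrArg φ (aeval_gen_minpoly ℚ β)
  rw [Polynomial.aeval_def, Polynomial.hom_eval₂, map_zero] at h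
  rw [Polynomial.aeval_def, ← h]
  congr 1
  exact Subsingleton.elim _ _

/-- An embedding of `ℚ(β)` is determined by the image of `β`; so the one conjugate not controlled by
the Pisot property is the real absolute value. -/
theorem embedding_eq_coe (φ : ℚ⟮β⟯ →+* ℂ) (hφ : φ (AdjoinSimple.gen ℚ β) = β) (z : ℚ⟮β⟯) :
    φ z = ((z : ℝ) : ℂ) := by
  have h : φ.toRatAlgHom = (Complex.ofRealHom.comp (algebraMap ℚ⟮β⟯ ℝ)).toRatAlgHom := by
    refine algHom_ext_of_eq_adjoin ℚ rfl ?_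
    intro x hx
    obtain rfl : x = β := hx
    exact hφ
  exact DFunLike.congr_fun h z

/-- There are finitely many embeddings, so the strict bounds are uniform; this makes the geometric
estimates below converge. -/
theorem IsPisot.exists_norm_embedding_gen_le (hβ : IsPisot β) :
    ∃ r : ℝ, 0 ≤ r ∧ r < 1 ∧ ∀ φ : ℚ⟮β⟯ →+* ℂ, φ (AdjoinSimple.gen ℚ β) ≠ β →
      ‖φ (AdjoinSimple.gen ℚ β)‖ ≤ r := by
  have := hβ.numberField
  have hfin : {φ : ℚ⟮β⟯ →+* ℂ | φ (AdjoinSimple.gen ℚ β) ≠ β}.Finite := Set.toFinite _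
  rcases Set.eq_empty_or_nonempty {φ : ℚ⟮β⟯ →+* ℂ | φ (AdjoinSimple.gen ℚ β) ≠ β} with h | h
  · exact ⟨0, le_rfl, one_pos, fun φ hφ => by
      have : φ ∈ (∅ : Set (ℚ⟮β⟯ →+* ℂ)) := h ▸ hφ
      simp at this⟩
  · obtain ⟨ψ, hψ, hmax⟩ := Set.exists_max_image _
      (fun φ : ℚ⟮β⟯ →+* ℂ => ‖φ (AdjoinSimple.gen ℚ β)‖) hfin h
    exact ⟨_, norm_nonneg _, hβ.norm_embedding_gen_lt ψ hψ, hmax⟩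

/-- Northcott's argument: after clearing the denominator `q`, these are algebraic integers of a
fixed number field with all conjugates bounded. -/
theorem IsPisot.finite_of_norm_embedding_le (hβ : IsPisot β) {q : ℤ} (hq : q ≠ 0) (A B : ℝ) :
    {z : ℚ⟮β⟯ | IsIntegral ℤ (q • z) ∧ |(z : ℝ)| ≤ A ∧
      ∀ φ : ℚ⟮β⟯ →+* ℂ, φ (AdjoinSimple.gen ℚ β) ≠ β → ‖φ z‖ ≤ B}.Finite := by
  have := hβ.numberField
  refine Set.Finite.of_finite_image (f := fun z => q • z)
    ((NumberField.Embeddings.finite_of_norm_le ℚ⟮β⟯ ℂ (|(q : ℝ)| * max A B)).subset ?_) ?_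
  · rintro _ ⟨z, ⟨hz, hA, hB⟩, rfl⟩
    refine ⟨hz, fun φ => ?_⟩
    have h1 : ‖φ (q • z)‖ = |(q : ℝ)| * ‖φ z‖ := by
      rw [zsmul_eq_mul, map_mul, map_intCast, norm_mul, Complex.norm_intCast]
    rw [h1]
    refine mul_le_mul_of_nonneg_left ?_ (abs_nonneg _)
    by_cases hφ : φ (AdjoinSimple.gen ℚ β) = β
    · rw [embedding_eq_coe φ hφ, Complex.norm_real]
      exact hA.trans (le_max_left _ _)
    · exact (hB φ hφ).trans (le_max_right _ _)
  · intro z _ z' _ h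
    exact smul_right_injective _ hq h

/-- The remainder `β ^ n * x - T ^ n x` is an algebraic integer of `ℚ(β)` whose nontrivial
conjugates are uniformly bounded. -/
theorem IsPisot.exists_betaMap_iterate_eq (hβ : IsPisot β) {r : ℝ} (hr0 : 0 ≤ r) (hr1 : r < 1)
    (hr : ∀ φ : ℚ⟮β⟯ →+* ℂ, φ (AdjoinSimple.gen ℚ β) ≠ β → ‖φ (AdjoinSimple.gen ℚ β)‖ ≤ r)
    (x : unitInterval) (n : ℕ) :
    ∃ P : ℚ⟮β⟯, IsIntegral ℤ P ∧
      (∀ φ : ℚ⟮β⟯ →+* ℂ, φ (AdjoinSimple.gen ℚ β) ≠ β → ‖φ P‖ ≤ β / (1 - r)) ∧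
      ((betaMap β)^[n] x : ℝ) = β ^ n * x - P := by
  have hβ0 : 0 < β := zero_lt_one.trans hβ.1
  have hr' : 0 < 1 - r := sub_pos.2 hr1
  induction n with
  | zero => exact ⟨0, isIntegral_zero, fun φ _ => by simpa using (div_pos hβ0 hr').le, by simp⟩
  | succ n ih =>
    obtain ⟨P, hP, hφP, hPx⟩ := ih
    set y := (betaMap β)^[n] x with hy
    refine ⟨AdjoinSimple.gen ℚ β * P + (⌊β * (y : ℝ)⌋ : ℤ),
      (hβ.isIntegral_gen.mul hP).add (isIntegral_algebraMap (R := ℤ) (x := ⌊β * (y : ℝ)⌋)),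
      fun φ hφ => ?_, ?_⟩
    · rw [map_add, map_mul, map_intCast]
      have h1 : ‖((⌊β * (y : ℝ)⌋ : ℤ) : ℂ)‖ ≤ β := by
        have h0 : (0 : ℤ) ≤ ⌊β * (y : ℝ)⌋ := Int.floor_nonneg.2 (mul_nonneg hβ0.le y.2.1)
        rw [Complex.norm_intCast, abs_of_nonneg (by exact_mod_cast h0)]
        exact (Int.floor_le _).trans (mul_le_of_le_one_right hβ0.le y.2.2)
      calc ‖φ (AdjoinSimple.gen ℚ β) * φ P + ((⌊β * (y : ℝ)⌋ : ℤ) : ℂ)‖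
          ≤ ‖φ (AdjoinSimple.gen ℚ β)‖ * ‖φ P‖ + ‖((⌊β * (y : ℝ)⌋ : ℤ) : ℂ)‖ :=
            (norm_add_le _ _).trans_eq (by rw [norm_mul])
        -- The digit is at most `β`, and `β / (1 - r)` is the fixed point of `t ↦ r * t + β`.
        _ ≤ r * (β / (1 - r)) + β := by
            gcongr
            · exact hr φ hφ
            · exact hφP φ hφ
        _ = β / (1 - r) := by field_simp; ring
    · rw [Function.iterate_succ_apply', ← hy, betaMap_coe, hPx, pow_succ]
      push_cast
      rw [AdjoinSimple.coe_gen]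
      ring

/-- Each `T^n 1 = β^n - P` is an algebraic integer in `[0, 1]` whose other conjugates are at most `1
+ β / (1 - r)` in modulus. -/
theorem IsPisot.finite_orbit_one (hβ : IsPisot β) :
    (Set.range fun n => ((betaMap β)^[n] 1 : unitInterval)).Finite := by
  obtain ⟨r, hr0, hr1, hr⟩ := hβ.exists_norm_embedding_gen_le
  have hfin := (hβ.finite_of_norm_embedding_le one_ne_zero 1 (1 + β / (1 - r))).image
    (Subtype.val : ℚ⟮β⟯ → ℝ)
  refine Set.Finite.of_finite_image (f := Subtype.val) (hfin.subset ?_)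
    Subtype.val_injective.injOn
  rintro _ ⟨_, ⟨n, rfl⟩, rfl⟩
  obtain ⟨P, hP, hφP, hPx⟩ := hβ.exists_betaMap_iterate_eq hr0 hr1 hr 1 n
  have hval : ((AdjoinSimple.gen ℚ β ^ n - P : ℚ⟮β⟯) : ℝ) = ((betaMap β)^[n] 1 : unitInterval) := by
    rw [hPx]
    push_cast
    rw [AdjoinSimple.coe_gen]
    simp
  refine ⟨AdjoinSimple.gen ℚ β ^ n - P, ⟨?_, ?_, fun φ hφ => ?_⟩, hval⟩
  · rw [one_smul]
    exact (hβ.isIntegral_gen.pow n).sub hP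
  · rw [hval, abs_of_nonneg ((betaMap β)^[n] 1).2.1]
    exact ((betaMap β)^[n] 1).2.2
  · rw [map_sub, map_pow]
    refine (norm_sub_le _ _).trans (add_le_add ?_ (hφP φ hφ))
    rw [norm_pow]
    exact pow_le_one₀ (norm_nonneg _) ((hr φ hφ).trans hr1.le)

theorem IsPisot.exists_pos_le_orbit_one (hβ : IsPisot β) :
    ∃ δ : ℝ, 0 < δ ∧ ∀ n, 0 < ((betaMap β)^[n] 1 : unitInterval) →
      δ ≤ ((betaMap β)^[n] 1 : unitInterval) := by
  have hfin : ((Set.range fun n => ((betaMap β)^[n] 1 : unitInterval)) ∩ Set.Ioi 0).Finite :=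
    hβ.finite_orbit_one.inter_of_left _
  have hne : ((Set.range fun n => ((betaMap β)^[n] 1 : unitInterval)) ∩ Set.Ioi 0).Nonempty :=
    ⟨1, ⟨0, rfl⟩, Set.mem_Ioi.2 zero_lt_one⟩
  obtain ⟨t, ht, hmin⟩ := Set.exists_min_image _ (fun t : unitInterval => (t : ℝ)) hfin hne
  exact ⟨t, ht.2, fun n hn => hmin _ ⟨⟨n, rfl⟩, hn⟩⟩

/-- For a piecewise affine map `S` with slopes `± β ^ m i` and intercepts in `ℚ(β)`, run in parallel
with the `β`-transformation, the two orbits differ by a sign and finitely many translations. -/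
theorem IsPisot.exists_finite_difference (hβ : IsPisot β) {ι : Type*} [Finite ι] {ε : ι → ℝ}
    (hε : ∀ i, ε i = 1 ∨ ε i = -1) {m : ι → ℕ} (hm : ∀ i, 1 ≤ m i) {b : ι → ℝ}
    (hb : ∀ i, b i ∈ ℚ⟮β⟯) {S : unitInterval → unitInterval} (idx : unitInterval → ι)
    (hS : ∀ x, (S x : ℝ) = ε (idx x) * β ^ m (idx x) * (x : ℝ) + b (idx x)) :
    ∃ F : Set ℝ, F.Finite ∧ ∀ x k, ∃ s d : ℝ, (s = 1 ∨ s = -1) ∧ d ∈ F ∧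
      ((betaMap β)^[birkhoffSum S (m ∘ idx) k x] x : ℝ) = s * (S^[k] x : ℝ) + d := by
  have := hβ.numberField
  have := Fintype.ofFinite ι
  classical
  obtain ⟨r, hr0, hr1, hr⟩ := hβ.exists_norm_embedding_gen_le
  have hr' : 0 < 1 - r := sub_pos.2 hr1
  have hβ0 : 0 < β := zero_lt_one.trans hβ.1
  lift b to ι → ℚ⟮β⟯ using hb
  have : Algebra.IsAlgebraic ℤ ℚ⟮β⟯ :=
    (IsFractionRing.comap_isAlgebraic_iff (A := ℤ) (K := ℚ) (C := ℚ⟮β⟯)).2 inferInstance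
  obtain ⟨q, hq, hqb⟩ := Algebra.IsAlgebraic.exists_integral_multiples ℤ (Finset.univ.image b)
  replace hqb : ∀ i, IsIntegral ℤ (q • b i) := fun i => hqb _ (by simp)
  obtain ⟨C, hC⟩ : ∃ C : ℝ, ∀ i, ∀ φ : ℚ⟮β⟯ →+* ℂ, ‖φ (b i)‖ ≤ C := by
    obtain ⟨C, hC⟩ := (Set.finite_range
      fun p : ι × (ℚ⟮β⟯ →+* ℂ) => ‖p.2 (b p.1)‖).bddAbove
    exact ⟨C, fun i φ => hC ⟨(i, φ), rfl⟩⟩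
  -- The fixed point of `t ↦ r * t + β / (1 - r) + |C|`, which bounds how the conjugates of the
  -- difference evolve in one step of `S`.
  set B : ℝ := (β / (1 - r) + |C|) / (1 - r) with hB
  have hB0 : 0 ≤ B := by positivity
  -- The bound `2`: a point of `[0, 1]` minus or plus another one.
  refine ⟨_, (hβ.finite_of_norm_embedding_le hq 2 B).image (Subtype.val : ℚ⟮β⟯ → ℝ),
    fun x k => ?_⟩
  suffices h : ∃ s : ℤ, (s = 1 ∨ s = -1) ∧ ∃ z : ℚ⟮β⟯, IsIntegral ℤ (q • z) ∧
      (∀ φ : ℚ⟮β⟯ →+* ℂ, φ (AdjoinSimple.gen ℚ β) ≠ β → ‖φ z‖ ≤ B) ∧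
      ((betaMap β)^[birkhoffSum S (m ∘ idx) k x] x : ℝ) = s * (S^[k] x : ℝ) + z by
    obtain ⟨s, hs, z, hz, hφz, hx⟩ := h
    have hs' : (s : ℝ) = 1 ∨ (s : ℝ) = -1 := by
      rcases hs with rfl | rfl <;> simp
    refine ⟨s, z, hs', ⟨z, ⟨hz, ?_, hφz⟩, rfl⟩, hx⟩
    have h1 := ((betaMap β)^[birkhoffSum S (m ∘ idx) k x] x).2
    have h2 := (S^[k] x).2
    rw [hx] at h1
    rw [abs_le]
    rcases hs' with h | h <;> rw [h] at h1 <;> constructor <;> linarith [h1.1, h1.2, h2.1, h2.2]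
  induction k with
  | zero =>
    exact ⟨1, Or.inl rfl, 0, by simpa using isIntegral_zero, fun φ _ => by simpa using hB0, by simp⟩
  | succ k ih =>
    obtain ⟨s, hs, z, hz, hφz, hx⟩ := ih
    rw [birkhoffSum_succ, add_comm, Function.iterate_add_apply, Function.iterate_succ_apply']
    set u := (betaMap β)^[birkhoffSum S (m ∘ idx) k x] x with hu
    set y := S^[k] x with hy
    obtain ⟨P, hP, hφP, hPx⟩ := hβ.exists_betaMap_iterate_eq hr0 hr1 hr u ((m ∘ idx) y)
    obtain ⟨e, he, heε⟩ : ∃ e : ℤ, (e = 1 ∨ e = -1) ∧ ε (idx y) = e := by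
      rcases hε (idx y) with h | h
      · exact ⟨1, Or.inl rfl, by simp [h]⟩
      · exact ⟨-1, Or.inr rfl, by simp [h]⟩
    have hse : s * e = 1 ∨ s * e = -1 := by
      rcases hs with rfl | rfl <;> rcases he with rfl | rfl <;> simp
    have hee : (e : ℝ) * e = 1 := by rcases he with rfl | rfl <;> simp
    -- From `u = s * y + z`, `T^m u = β^m * u - P` and `S y = e * β^m * y + b`, eliminate `β^m * y`
    -- using `e * e = 1`.
    refine ⟨s * e, hse, AdjoinSimple.gen ℚ β ^ ((m ∘ idx) y) * z - P - (s * e) • b (idx y),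
      ?_, fun φ hφ => ?_, ?_⟩
    · rw [smul_sub, smul_sub, ← mul_smul_comm, smul_comm q (s * e)]
      exact (((hβ.isIntegral_gen.pow _).mul hz).sub (hP.smul q)).sub ((hqb _).smul (s * e))
    · have h1 : ‖φ ((s * e) • b (idx y))‖ ≤ |C| := by
        refine le_trans (le_of_eq ?_) ((hC (idx y) φ).trans (le_abs_self C))
        rcases hse with h | h <;> rw [h] <;> simp
      -- This contraction needs exponents at least one.
      have h2 : ‖φ (AdjoinSimple.gen ℚ β) ^ ((m ∘ idx) y)‖ ≤ r := by
        rw [norm_pow]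
        calc ‖φ (AdjoinSimple.gen ℚ β)‖ ^ ((m ∘ idx) y) ≤ r ^ ((m ∘ idx) y) := by
              gcongr
              exact hr φ hφ
          _ ≤ r ^ 1 := pow_le_pow_of_le_one hr0 hr1.le (hm _)
          _ = r := pow_one r
      rw [map_sub, map_sub, map_mul, map_pow]
      calc ‖φ (AdjoinSimple.gen ℚ β) ^ ((m ∘ idx) y) * φ z - φ P - φ ((s * e) • b (idx y))‖
          ≤ ‖φ (AdjoinSimple.gen ℚ β) ^ ((m ∘ idx) y)‖ * ‖φ z‖ + ‖φ P‖ +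
              ‖φ ((s * e) • b (idx y))‖ := by
            rw [← norm_mul]
            exact (norm_sub_le _ _).trans (add_le_add_left (norm_sub_le _ _) _)
        _ ≤ r * B + β / (1 - r) + |C| := by
            gcongr
            · exact hφz φ hφ
            · exact hφP φ hφ
        _ = B := by
            rw [hB]
            field_simp
            ring
    · rw [hPx, hx, hS y, heε]
      push_cast
      rw [AdjoinSimple.coe_gen, Function.comp_apply]
      simp only [zsmul_eq_mul]
      push_cast
      linear_combination (-(s : ℝ) * β ^ m (idx y) * y) * hee

end Arithmetic

/-! ### Parry's invariant measure -/

theorem volume_Ico_inter_fract_preimage {E : Set ℝ} (hE : MeasurableSet E) (n : ℕ) {r : ℝ}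
    (hr0 : 0 ≤ r) (hr1 : r < 1) :
    volume (Set.Ico 0 (n + r) ∩ Int.fract ⁻¹' E) =
      n * volume (E ∩ Set.Ico 0 1) + volume (E ∩ Set.Ico 0 r) := by
  induction n with
  | zero =>
    simp only [Nat.cast_zero, zero_add, zero_mul]
    congr 1
    ext z
    simp only [Set.mem_inter_iff, Set.mem_Ico, Set.mem_preimage]
    constructor
    · rintro ⟨hz, h⟩
      rw [Int.fract_eq_self.2 ⟨hz.1, hz.2.trans hr1⟩] at h
      exact ⟨h, hz⟩
    · rintro ⟨h, hz⟩
      rw [Int.fract_eq_self.2 ⟨hz.1, hz.2.trans hr1⟩]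
      exact ⟨hz, h⟩
  | succ n ih =>
    have hn : (0 : ℝ) ≤ n := Nat.cast_nonneg n
    have hsplit : Set.Ico 0 (((n + 1 : ℕ) : ℝ) + r) ∩ Int.fract ⁻¹' E =
        (E ∩ Set.Ico 0 1) ∪ (fun z : ℝ => z + (-1)) ⁻¹' (Set.Ico 0 (n + r) ∩ Int.fract ⁻¹' E) := by
      ext z
      have hf : Int.fract (z + (-1)) = Int.fract z := by
        rw [← sub_eq_add_neg]
        exact Int.fract_sub_one z
      simp only [Set.mem_inter_iff, Set.mem_Ico, Set.mem_preimage, Set.mem_union, hf,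
        Nat.cast_add, Nat.cast_one]
      constructor
      · rintro ⟨⟨h0, h1⟩, h⟩
        rcases lt_or_ge z 1 with hz | hz
        · rw [Int.fract_eq_self.2 ⟨h0, hz⟩] at h
          exact Or.inl ⟨h, h0, hz⟩
        · exact Or.inr ⟨⟨by linarith, by linarith⟩, h⟩
      · rintro (⟨h, h0, h1⟩ | ⟨⟨h0, h1⟩, h⟩)
        · rw [Int.fract_eq_self.2 ⟨h0, h1⟩]
          exact ⟨⟨h0, by linarith⟩, h⟩
        · exact ⟨⟨by linarith, by linarith⟩, h⟩
    rw [hsplit, measure_union _ (measurable_add_const (-1 : ℝ)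
      (measurableSet_Ico.inter (measurable_fract hE))), measure_preimage_add_right, ih]
    · push_cast
      ring
    · rw [Set.disjoint_left]
      rintro z ⟨_, _, hz⟩ ⟨⟨hz', _⟩, _⟩
      linarith

/-- Stretching `[0, a)` by `β` and reducing modulo one covers `[0, 1)` fully `⌊β * a⌋` times and
then `[0, T a)` once more. -/
theorem volume_betaMap_preimage_inter_Iio {β : ℝ} (hβ : 0 < β) {E : Set unitInterval}
    (hE : MeasurableSet E) (a : unitInterval) :
    volume (betaMap β ⁻¹' E ∩ Set.Iio a) =
      ENNReal.ofReal β⁻¹ * (⌊β * (a : ℝ)⌋₊ * volume E + volume (E ∩ Set.Iio (betaMap β a))) := by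
  have hE' : MeasurableSet (Subtype.val '' E : Set ℝ) := measurableSet_Icc.subtype_image hE
  have hβa : 0 ≤ β * (a : ℝ) := mul_nonneg hβ.le a.2.1
  have h1 : (Subtype.val '' (betaMap β ⁻¹' E ∩ Set.Iio a) : Set ℝ) = (fun x => β * x) ⁻¹'
      (Set.Ico 0 (⌊β * (a : ℝ)⌋₊ + Int.fract (β * (a : ℝ))) ∩
        Int.fract ⁻¹' (Subtype.val '' E)) := by
    have h2 : (⌊β * (a : ℝ)⌋₊ : ℝ) + Int.fract (β * (a : ℝ)) = β * a := by
      rw [natCast_floor_eq_intCast_floor hβa, Int.floor_add_fract]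
    rw [h2]
    ext x
    constructor
    · rintro ⟨y, ⟨hyE, hya⟩, rfl⟩
      refine ⟨⟨mul_nonneg hβ.le y.2.1, mul_lt_mul_of_pos_left hya hβ⟩, ⟨betaMap β y, hyE, rfl⟩⟩
    · rintro ⟨⟨h0, h1⟩, ⟨u, hu, hux⟩⟩
      have hx0 : 0 ≤ x := nonneg_of_mul_nonneg_right h0 hβ
      have hxa : x < a := lt_of_mul_lt_mul_left h1 hβ.le
      refine ⟨⟨x, hx0, hxa.le.trans a.2.2⟩, ⟨?_, hxa⟩, rfl⟩
      have : betaMap β ⟨x, hx0, hxa.le.trans a.2.2⟩ = u := Subtype.ext hux.symm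
      rw [Set.mem_preimage, this]
      exact hu
  have h3 : volume (Subtype.val '' E ∩ Set.Ico (0 : ℝ) 1) = volume E := by
    rw [unitInterval.volume_apply]
    refine measure_congr ?_
    have : ∀ᵐ x : ℝ, x ≠ 1 := by simp [ae_iff]
    filter_upwards [this] with x hx
    refine propext ⟨fun h => h.1, fun h => ⟨h, ?_⟩⟩
    obtain ⟨y, _, rfl⟩ := h
    exact ⟨y.2.1, lt_of_le_of_ne y.2.2 hx⟩
  have h4 : (Subtype.val '' E ∩ Set.Ico (0 : ℝ) (Int.fract (β * (a : ℝ)))) =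
      Subtype.val '' (E ∩ Set.Iio (betaMap β a)) := by
    ext x
    constructor
    · rintro ⟨⟨y, hy, rfl⟩, hx⟩
      exact ⟨y, ⟨hy, hx.2⟩, rfl⟩
    · rintro ⟨y, ⟨hy, hya⟩, rfl⟩
      exact ⟨⟨y, hy, rfl⟩, y.2.1, hya⟩
  rw [unitInterval.volume_apply, h1, Real.volume_preimage_mul_left hβ.ne',
    volume_Ico_inter_fract_preimage hE' _ (Int.fract_nonneg _) (Int.fract_lt_one _), h3, h4,
    ← unitInterval.volume_apply, abs_of_pos (inv_pos.2 hβ)]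

/-- Parry's (unnormalized) invariant measure `∑ β⁻ⁿ · λ|_{[0, Tⁿ 1)}`. -/
noncomputable def parryMeasure (β : ℝ) : Measure unitInterval :=
  Measure.sum fun n : ℕ =>
    ENNReal.ofReal ((β ^ n)⁻¹) • volume.restrict (Set.Iio ((betaMap β)^[n] 1))

theorem parryMeasure_apply (β : ℝ) {E : Set unitInterval} (hE : MeasurableSet E) :
    parryMeasure β E =
      ∑' n : ℕ, ENNReal.ofReal ((β ^ n)⁻¹) * volume (E ∩ Set.Iio ((betaMap β)^[n] 1)) := by
  simp only [parryMeasure, Measure.sum_apply _ hE, Measure.smul_apply, Measure.restrict_apply hE,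
    smul_eq_mul]

theorem volume_inter_Iio_one (E : Set unitInterval) : volume (E ∩ Set.Iio 1) = volume E := by
  refine measure_congr ?_
  have : ∀ᵐ x : unitInterval, x ≠ 1 := by simp [ae_iff]
  filter_upwards [this] with x hx
  exact propext ⟨fun h => h.1, fun h => ⟨h, lt_of_le_of_ne unitInterval.le_one' hx⟩⟩

theorem volume_le_parryMeasure (β : ℝ) {E : Set unitInterval} (hE : MeasurableSet E) :
    volume E ≤ parryMeasure β E := by
  rw [parryMeasure_apply β hE]
  refine le_trans (le_of_eq ?_) (ENNReal.le_tsum 0)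
  simp [volume_inter_Iio_one]

theorem exists_parryMeasure_le {β : ℝ} (hβ : 1 < β) :
    ∃ C : ENNReal, C ≠ ⊤ ∧ ∀ E, MeasurableSet E → parryMeasure β E ≤ C * volume E := by
  refine ⟨∑' n : ℕ, ENNReal.ofReal ((β ^ n)⁻¹), ?_, fun E hE => ?_⟩
  · have : Summable fun n : ℕ => (β ^ n)⁻¹ := by
      simpa using summable_geometric_of_lt_one (inv_nonneg.2 (zero_le_one.trans hβ.le))
        (inv_lt_one_of_one_lt₀ hβ)
    exact this.tsum_ofReal_ne_top
  · rw [parryMeasure_apply β hE, ← ENNReal.tsum_mul_right]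
    exact ENNReal.tsum_le_tsum fun n => mul_le_mul_right (measure_mono Set.inter_subset_left) _

/-- The greedy expansion of `1` in base `β`. -/
theorem tsum_ofReal_greedy_digits {β : ℝ} (hβ : 1 < β) :
    ∑' n : ℕ, ENNReal.ofReal ((β ^ (n + 1))⁻¹) *
      (⌊β * (((betaMap β)^[n] 1 : unitInterval) : ℝ)⌋₊ : ENNReal) = 1 := by
  have hβ0 : 0 < β := zero_lt_one.trans hβ
  set t : ℕ → ℝ := fun n => ((betaMap β)^[n] 1 : unitInterval) with ht
  have ht0 : ∀ n, 0 ≤ t n := fun n => ((betaMap β)^[n] 1).2.1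
  have ht1 : ∀ n, t n ≤ 1 := fun n => ((betaMap β)^[n] 1).2.2
  -- The digit is `β * t n - t (n + 1)`, so the series telescopes.
  have hstep : ∀ n, (β ^ (n + 1))⁻¹ * (⌊β * t n⌋₊ : ℝ) =
      (β ^ n)⁻¹ * t n - (β ^ (n + 1))⁻¹ * t (n + 1) := fun n => by
    have : t (n + 1) = β * t n - ⌊β * t n⌋₊ := by
      rw [natCast_floor_eq_intCast_floor (mul_nonneg hβ0.le (ht0 n))]
      simp only [ht, Function.iterate_succ_apply', betaMap_coe]
    rw [this]
    field_simp
    ring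
  have hlim : Tendsto (fun n => (β ^ n)⁻¹ * t n) atTop (𝓝 0) := by
    refine squeeze_zero (fun n => mul_nonneg (by positivity) (ht0 n))
      (fun n => mul_le_of_le_one_right (by positivity) (ht1 n)) ?_
    simpa using tendsto_pow_atTop_nhds_zero_of_lt_one (inv_nonneg.2 hβ0.le)
      (inv_lt_one_of_one_lt₀ hβ)
  have hsum : HasSum (fun n => (β ^ (n + 1))⁻¹ * (⌊β * t n⌋₊ : ℝ)) 1 := by
    rw [hasSum_iff_tendsto_nat_of_nonneg (fun n => by positivity)]
    simp only [hstep, Finset.sum_range_sub' fun n => (β ^ n)⁻¹ * t n]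
    have h0 : (β ^ 0)⁻¹ * t 0 = 1 := by simp [ht]
    have h1 := hlim.const_sub ((β ^ 0)⁻¹ * t 0)
    rw [h0, sub_zero] at h1
    rwa [h0]
  calc ∑' n : ℕ, ENNReal.ofReal ((β ^ (n + 1))⁻¹) * (⌊β * t n⌋₊ : ENNReal)
      = ∑' n : ℕ, ENNReal.ofReal ((β ^ (n + 1))⁻¹ * (⌊β * t n⌋₊ : ℝ)) := by
        refine tsum_congr fun n => ?_
        rw [ENNReal.ofReal_mul (by positivity), ENNReal.ofReal_natCast]
    _ = 1 := by
        rw [← ENNReal.ofReal_tsum_of_nonneg (fun n => by positivity) hsum.summable, hsum.tsum_eq,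
          ENNReal.ofReal_one]

/-- Pulling back the `n`-th term yields a partial covering, which is the term of index `n + 1`, and
full coverings, which sum to `volume E` by the greedy expansion of `1` and restore the term of index
`0`. -/
theorem measurePreserving_parryMeasure {β : ℝ} (hβ : 1 < β) :
    MeasurePreserving (betaMap β) (parryMeasure β) (parryMeasure β) := by
  have hβ0 : 0 < β := zero_lt_one.trans hβ
  refine ⟨measurable_betaMap β, Measure.ext fun E hE => ?_⟩
  rw [Measure.map_apply (measurable_betaMap β) hE,
    parryMeasure_apply β (measurable_betaMap β hE), parryMeasure_apply β hE]
  have hterm : ∀ n : ℕ, ENNReal.ofReal ((β ^ n)⁻¹) *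
      volume (betaMap β ⁻¹' E ∩ Set.Iio ((betaMap β)^[n] 1)) =
      ENNReal.ofReal ((β ^ (n + 1))⁻¹) *
        (⌊β * (((betaMap β)^[n] 1 : unitInterval) : ℝ)⌋₊ : ENNReal) * volume E +
      ENNReal.ofReal ((β ^ (n + 1))⁻¹) * volume (E ∩ Set.Iio ((betaMap β)^[n + 1] 1)) := by
    intro n
    rw [volume_betaMap_preimage_inter_Iio hβ0 hE, ← mul_assoc,
      ← ENNReal.ofReal_mul (by positivity), ← mul_inv, ← pow_succ, mul_add, mul_assoc,
      Function.iterate_succ_apply']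
  simp only [hterm]
  rw [ENNReal.tsum_add, ENNReal.tsum_mul_right, tsum_ofReal_greedy_digits hβ,
    tsum_eq_zero_add' (f := fun n : ℕ => ENNReal.ofReal ((β ^ n)⁻¹) *
      volume (E ∩ Set.Iio ((betaMap β)^[n] 1))) ENNReal.summable]
  simp [volume_inter_Iio_one]

/-! ### Ergodicity of the `β`-transformation -/

/-- Every point lies in an interval of rank `n` on which `T ^ n` is affine with image
`[0, T ^ k 1)` for some `k`. -/
theorem exists_cylinder {β : ℝ} (hβ : 1 < β) {x : unitInterval} (hx : (x : ℝ) < 1) (n : ℕ) :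
    ∃ (a : ℝ) (k : ℕ), 0 ≤ a ∧ (((betaMap β)^[k] 1 : unitInterval) : ℝ) ≤ β ^ n * (1 - a) ∧
      0 ≤ β ^ n * (x - a) ∧ β ^ n * (x - a) < (((betaMap β)^[k] 1 : unitInterval) : ℝ) ∧
      ∀ y : unitInterval, 0 ≤ β ^ n * (y - a) →
        β ^ n * (y - a) < (((betaMap β)^[k] 1 : unitInterval) : ℝ) →
        ((betaMap β)^[n] y : ℝ) = β ^ n * (y - a) := by
  have hβ0 : 0 < β := zero_lt_one.trans hβ
  induction n with
  | zero =>
    exact ⟨0, 0, le_rfl, by simp, by simpa using x.2.1, by simpa using hx, fun y _ _ => by simp⟩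
  | succ n ih =>
    obtain ⟨a, k, ha, h1, hx0, hxt, hT⟩ := ih
    set t : ℝ := (((betaMap β)^[k] 1 : unitInterval) : ℝ) with ht
    set u : ℝ := β ^ n * (x - a) with hu
    have hp : 0 < β ^ (n + 1) := by positivity
    have hj0 : (0 : ℝ) ≤ ⌊β * u⌋ := by
      exact_mod_cast Int.floor_nonneg.2 (mul_nonneg hβ0.le hx0)
    have hju : (⌊β * u⌋ : ℝ) ≤ β * u := Int.floor_le _
    have huj : β * u < ⌊β * u⌋ + 1 := Int.lt_floor_add_one _
    have hut : β * u < β * t := mul_lt_mul_of_pos_left hxt hβ0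
    -- Either the next digit leaves a full branch, with image `[0, 1)` and `k' = 0`, or it is the
    -- last digit and the branch is truncated, with image `[0, T^{k+1} 1)`.
    obtain ⟨k', hk'1, hk'2⟩ : ∃ k' : ℕ,
        (((betaMap β)^[k'] 1 : unitInterval) : ℝ) + ⌊β * u⌋ ≤ β * t ∧
        β * u < (((betaMap β)^[k'] 1 : unitInterval) : ℝ) + ⌊β * u⌋ := by
      rcases le_or_gt ((⌊β * u⌋ : ℝ) + 1) (β * t) with h | h
      · exact ⟨0, by simpa [add_comm] using h, by simp [add_comm]⟩
      · refine ⟨k + 1, ?_⟩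
        have hfl : ⌊β * t⌋ = ⌊β * u⌋ := Int.floor_eq_iff.2 ⟨hju.trans hut.le, h⟩
        rw [Function.iterate_succ_apply', betaMap_coe, ← ht, hfl, sub_add_cancel]
        exact ⟨le_rfl, hut⟩
    have hk'3 : (((betaMap β)^[k'] 1 : unitInterval) : ℝ) ≤ 1 := ((betaMap β)^[k'] 1).2.2
    set t' : ℝ := (((betaMap β)^[k'] 1 : unitInterval) : ℝ) with ht'
    have key : ∀ y : ℝ, β ^ (n + 1) * (y - (a + ⌊β * u⌋ / β ^ (n + 1))) =
        β * (β ^ n * (y - a)) - ⌊β * u⌋ := fun y => by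
      field_simp
      ring
    refine ⟨a + ⌊β * u⌋ / β ^ (n + 1), k', by positivity, ?_, ?_, ?_, fun y hy0 hyt => ?_⟩
    · rw [key]
      have := mul_le_mul_of_nonneg_left h1 hβ0.le
      linarith
    · rw [key]
      linarith
    · rw [key]
      linarith
    · rw [key] at hy0 hyt ⊢
      have hy1 : 0 ≤ β ^ n * (y - a) := nonneg_of_mul_nonneg_right (by linarith) hβ0
      have hy2 : β ^ n * (y - a) < t := lt_of_mul_lt_mul_left (by linarith) hβ0.le
      rw [Function.iterate_succ_apply', betaMap_coe, hT y hy1 hy2]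
      have : ⌊β * (β ^ n * (y - a))⌋ = ⌊β * u⌋ :=
        Int.floor_eq_iff.2 ⟨by linarith, by linarith⟩
      rw [this]

/-- The trace of an invariant set on a cylinder is a scaled copy of its trace on the image. -/
theorem volume_inter_cylinder {β : ℝ} (hβ : 1 < β) {E : Set unitInterval}
    (hinv : betaMap β ⁻¹' E = E) {n : ℕ} {a t : ℝ} (ha : 0 ≤ a) (h1 : t ≤ β ^ n * (1 - a))
    (hT : ∀ y : unitInterval, 0 ≤ β ^ n * (y - a) → β ^ n * (y - a) < t →
      ((betaMap β)^[n] y : ℝ) = β ^ n * (y - a)) :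
    volume (Subtype.val '' E ∩ Set.Icc a (a + t / β ^ n)) =
      ENNReal.ofReal (β ^ n)⁻¹ * volume (Subtype.val '' E ∩ Set.Ico (0 : ℝ) t) := by
  have hβ0 : 0 < β := zero_lt_one.trans hβ
  have hp : 0 < β ^ n := by positivity
  have hinvn : ∀ y : unitInterval, (betaMap β)^[n] y ∈ E ↔ y ∈ E := fun y => by
    have h : (betaMap β)^[n] ⁻¹' E = E := by
      rw [Set.preimage_iterate_eq]
      exact Function.iterate_fixed hinv n
    rw [← Set.mem_preimage, h]
  have hset : (Subtype.val '' E ∩ Set.Ico a (a + t / β ^ n) : Set ℝ) =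
      (fun y => y + -a) ⁻¹' ((fun z => β ^ n * z) ⁻¹' (Subtype.val '' E ∩ Set.Ico (0 : ℝ) t)) := by
    ext y
    have hiff : y ∈ Set.Ico a (a + t / β ^ n) ↔ 0 ≤ β ^ n * (y - a) ∧ β ^ n * (y - a) < t := by
      rw [Set.mem_Ico, mul_nonneg_iff_of_pos_left hp, sub_nonneg, ← lt_div_iff₀' hp,
        sub_lt_iff_lt_add']
    simp only [Set.mem_inter_iff, hiff, Set.mem_preimage, Set.mem_Ico, ← sub_eq_add_neg]
    refine and_congr_left fun hy => ?_
    have hya : a ≤ y := sub_nonneg.1 ((mul_nonneg_iff_of_pos_left hp).1 hy.1)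
    have hy1 : y ≤ 1 := by
      have := lt_of_mul_lt_mul_left (hy.2.trans_le h1) hp.le
      linarith
    have hval := hT ⟨y, ha.trans hya, hy1⟩ hy.1 hy.2
    constructor
    · rintro ⟨z, hz, rfl⟩
      exact ⟨_, (hinvn z).2 hz, hval⟩
    · rintro ⟨z, hz, hzy⟩
      have : (betaMap β)^[n] ⟨y, ha.trans hya, hy1⟩ = z := Subtype.ext (hval.trans hzy.symm)
      exact ⟨⟨y, ha.trans hya, hy1⟩, (hinvn _).1 (this ▸ hz), rfl⟩
  rw [measure_congr ((ae_eq_refl _).inter Ico_ae_eq_Icc.symm), hset, measure_preimage_add_right,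
    Real.volume_preimage_mul_left hp.ne', abs_of_pos (inv_pos.2 hp)]

/-- An invariant set of positive measure fills a fixed neighbourhood of the origin. -/
theorem volume_Ico_diff_eq_zero_of_invariant {β : ℝ} (hβ : 1 < β) {δ : ℝ}
    (hδ : ∀ n, 0 < ((betaMap β)^[n] 1 : unitInterval) → δ ≤ ((betaMap β)^[n] 1 : unitInterval))
    {E : Set unitInterval} (hE : MeasurableSet E) (hinv : betaMap β ⁻¹' E = E)
    (hE0 : volume E ≠ 0) :
    volume (Set.Ico 0 δ \ (Subtype.val '' E : Set ℝ)) = 0 := by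
  have hβ0 : 0 < β := zero_lt_one.trans hβ
  have hE' : MeasurableSet (Subtype.val '' E : Set ℝ) := measurableSet_Icc.subtype_image hE
  rw [unitInterval.volume_apply] at hE0
  have hne : (ae (volume.restrict (Subtype.val '' E : Set ℝ))).NeBot :=
    ae_neBot.2 (by rwa [Ne, Measure.restrict_eq_zero])
  have hne1 : ∀ᵐ x ∂(volume.restrict (Subtype.val '' E : Set ℝ)), x ≠ 1 :=
    ae_restrict_of_ae (by simp [ae_iff])
  -- A density point of `E`, in the form allowing balls not centred at `x`, since cylinders need not
  -- be; `1` is excluded because cylinders cover only `[0, 1)`.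
  obtain ⟨x, hdens, ⟨⟨x, hxE, rfl⟩, hx1⟩⟩ :=
    ((IsUnifLocDoublingMeasure.ae_tendsto_measure_inter_div (volume : Measure ℝ)
      (Subtype.val '' E) 1).and ((ae_restrict_mem hE').and hne1)).exists
  have hx1' : (x : ℝ) < 1 := lt_of_le_of_ne x.2.2 hx1
  choose a k ha h1 hx0 hxt hT using fun n => exists_cylinder hβ hx1' n
  set t : ℕ → ℝ := fun n => (((betaMap β)^[k n] 1 : unitInterval) : ℝ) with ht
  have htpos : ∀ n, 0 < t n := fun n => (hx0 n).trans_lt (hxt n)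
  have htle : ∀ n, t n ≤ 1 := fun n => ((betaMap β)^[k n] 1).2.2
  have hp : ∀ n, 0 < β ^ n := fun n => by positivity
  have hball : ∀ n, Metric.closedBall (a n + t n / β ^ n / 2) (t n / β ^ n / 2) =
      Set.Icc (a n) (a n + t n / β ^ n) := fun n => by
    rw [Real.closedBall_eq_Icc]
    congr 1 <;> ring
  have hrad : Tendsto (fun n => t n / β ^ n / 2) atTop (𝓝[>] 0) := by
    refine tendsto_nhdsWithin_iff.2 ⟨?_, Eventually.of_forall fun n =>
      half_pos (div_pos (htpos n) (hp n))⟩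
    have h0 : Tendsto (fun n => (β⁻¹) ^ n) atTop (𝓝 0) :=
      tendsto_pow_atTop_nhds_zero_of_lt_one (inv_nonneg.2 hβ0.le) (inv_lt_one_of_one_lt₀ hβ)
    refine squeeze_zero (fun n => (half_pos (div_pos (htpos n) (hp n))).le) (fun n => ?_) h0
    refine (half_le_self (div_pos (htpos n) (hp n)).le).trans ?_
    rw [inv_pow, ← one_div]
    exact div_le_div_of_nonneg_right (htle n) (hp n).le
  have hlim := hdens (fun n => a n + t n / β ^ n / 2) (fun n => t n / β ^ n / 2) hrad
    (Eventually.of_forall fun n => by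
      rw [one_mul, hball n, Set.mem_Icc]
      constructor
      · exact sub_nonneg.1 ((mul_nonneg_iff_of_pos_left (hp n)).1 (hx0 n))
      · have := (lt_div_iff₀' (hp n)).2 (hxt n)
        linarith)
  simp only [hball] at hlim
  have hV : ∀ n, volume (Subtype.val '' E ∩ Set.Ico (0 : ℝ) (t n)) ≠ ⊤ := fun n =>
    ((measure_mono Set.inter_subset_right).trans_lt measure_Ico_lt_top).ne
  -- The density of `E` in the cylinder around `x` is its density in `[0, t n)`, so the latter tends
  -- to one.
  have hratio : ∀ n, volume (Subtype.val '' E ∩ Set.Icc (a n) (a n + t n / β ^ n)) /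
      volume (Set.Icc (a n) (a n + t n / β ^ n)) =
      volume (Subtype.val '' E ∩ Set.Ico (0 : ℝ) (t n)) / ENNReal.ofReal (t n) := fun n => by
    have hβn : ENNReal.ofReal (β ^ n)⁻¹ ≠ 0 := by
      simpa using inv_pos.2 (hp n)
    rw [volume_inter_cylinder hβ hinv (ha n) (h1 n) (hT n), Real.volume_Icc, add_sub_cancel_left,
      div_eq_inv_mul, ENNReal.ofReal_mul (inv_pos.2 (hp n)).le,
      ENNReal.mul_div_mul_left _ _ hβn ENNReal.ofReal_ne_top]
  simp only [hratio] at hlim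
  have hle : ∀ n, volume (Set.Ico 0 δ \ (Subtype.val '' E : Set ℝ)) +
      volume (Subtype.val '' E ∩ Set.Ico (0 : ℝ) (t n)) / ENNReal.ofReal (t n) ≤ 1 := fun n => by
    have h0 : ENNReal.ofReal (t n) ≠ 0 := by simpa using htpos n
    have h2 : volume (Set.Ico 0 δ \ (Subtype.val '' E : Set ℝ)) +
        volume (Subtype.val '' E ∩ Set.Ico (0 : ℝ) (t n)) ≤ ENNReal.ofReal (t n) := by
      calc _ ≤ volume (Set.Ico 0 (t n) \ (Subtype.val '' E : Set ℝ)) +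
            volume (Set.Ico (0 : ℝ) (t n) ∩ Subtype.val '' E) := by
              rw [Set.inter_comm]
              gcongr
              exact hδ (k n) (htpos n)
        _ = volume (Set.Ico (0 : ℝ) (t n)) := measure_sdiff_add_inter _ hE'
        _ = ENNReal.ofReal (t n) := by simp
    calc _ ≤ volume (Set.Ico 0 δ \ (Subtype.val '' E : Set ℝ)) / ENNReal.ofReal (t n) +
          volume (Subtype.val '' E ∩ Set.Ico (0 : ℝ) (t n)) / ENNReal.ofReal (t n) := by
            gcongr
            -- Since `t n ≤ 1`, dividing by `t n` only enlarges the missing mass, so a bound free of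
            -- `n` survives in the limit.
            rw [ENNReal.le_div_iff_mul_le (Or.inl h0) (Or.inl ENNReal.ofReal_ne_top)]
            exact mul_le_of_le_one_right (zero_le) (by simpa using htle n)
      _ ≤ 1 := by
            rw [← ENNReal.add_div]
            exact ENNReal.div_le_of_le_mul (by rwa [one_mul])
  have h3 := le_of_tendsto' (tendsto_const_nhds.add hlim) hle
  by_contra hcon
  have h4 : (1 : ENNReal) < volume (Set.Ico 0 δ \ (Subtype.val '' E : Set ℝ)) + 1 := by
    rw [add_comm]
    exact ENNReal.lt_add_right ENNReal.one_ne_top hcon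
  exact absurd h3 (not_le.2 h4)

theorem IsPisot.preErgodic_betaMap {β : ℝ} (hβ : IsPisot β) {μ : Measure unitInterval}
    (hμ : μ ≪ volume) : PreErgodic (betaMap β) μ := by
  refine ⟨fun E hE hinv => ?_⟩
  obtain ⟨δ, hδ0, hδ⟩ := hβ.exists_pos_le_orbit_one
  have h : volume E = 0 ∨ volume Eᶜ = 0 := by
    by_contra! hcon
    have h1 := volume_Ico_diff_eq_zero_of_invariant hβ.1 hδ hE hinv hcon.1
    have h2 := volume_Ico_diff_eq_zero_of_invariant hβ.1 hδ hE.compl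
      (by rw [Set.preimage_compl, hinv]) hcon.2
    have h3 : Set.Ico 0 δ ⊆ (Set.Ico 0 δ \ (Subtype.val '' E : Set ℝ)) ∪
        (Set.Ico 0 δ \ (Subtype.val '' Eᶜ : Set ℝ)) := by
      intro x hx
      by_cases hxE : x ∈ (Subtype.val '' E : Set ℝ)
      · refine Or.inr ⟨hx, ?_⟩
        rintro ⟨y, hy, hyx⟩
        obtain ⟨z, hz, hzx⟩ := hxE
        exact hy ((Subtype.ext (hzx.trans hyx.symm) : z = y) ▸ hz)
      · exact Or.inl ⟨hx, hxE⟩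
    have h4 := measure_mono_null h3 (measure_union_null h1 h2)
    simp only [Real.volume_Ico, sub_zero, ENNReal.ofReal_eq_zero] at h4
    exact absurd h4 (not_le.2 hδ0)
  rw [eventuallyConst_set']
  rcases h with h | h
  · exact Or.inl (ae_eq_empty.2 (hμ h))
  · exact Or.inr (ae_eq_univ.2 (hμ h))

/-! ### Comparison of generic points -/

theorem StrictMono.exists_le_lt_succ {f : ℕ → ℕ} (hf : StrictMono f) (h0 : f 0 = 0) (n : ℕ) :
    ∃ k, f k ≤ n ∧ n < f (k + 1) := by
  induction n with
  | zero => exact ⟨0, h0.le, lt_of_eq_of_lt h0.symm (hf Nat.zero_lt_one)⟩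
  | succ n ih =>
    obtain ⟨k, h1, h2⟩ := ih
    rcases lt_or_ge (n + 1) (f (k + 1)) with h | h
    · exact ⟨k, by omega, h⟩
    · exact ⟨k + 1, h, by have := hf (Nat.lt_add_one (k + 1)); omega⟩

theorem birkhoffSum_le_mul {α : Type*} (S : α → α) {g : α → ℕ} {Q : ℕ} (hg : ∀ x, g x ≤ Q)
    (k : ℕ) (x : α) : birkhoffSum S g k x ≤ Q * k := by
  simpa [birkhoffSum, mul_comm] using
    Finset.sum_le_card_nsmul (Finset.range k) (fun j => g (S^[j] x)) Q fun j _ => hg _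

theorem strictMono_birkhoffSum {α : Type*} (S : α → α) {g : α → ℕ} (hg : ∀ x, 1 ≤ g x) (x : α) :
    StrictMono fun k => birkhoffSum S g k x :=
  strictMono_nat_of_lt_succ fun k => by
    rw [birkhoffSum_succ]
    have := hg (S^[k] x)
    omega

/-- The constant is independent of `n` because Parry's measure is invariant and comparable to
volume. -/
theorem exists_volume_iterate_betaMap_preimage_le {β : ℝ} (hβ : 1 < β) :
    ∃ C : ENNReal, C ≠ ⊤ ∧ ∀ (n : ℕ) (E : Set unitInterval), MeasurableSet E →
      volume ((betaMap β)^[n] ⁻¹' E) ≤ C * volume E := by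
  obtain ⟨C, hC, h⟩ := exists_parryMeasure_le hβ
  refine ⟨C, hC, fun n E hE => ?_⟩
  have hinv := (measurePreserving_parryMeasure hβ).iterate n
  calc volume ((betaMap β)^[n] ⁻¹' E) ≤ parryMeasure β ((betaMap β)^[n] ⁻¹' E) :=
        volume_le_parryMeasure β (hinv.measurable hE)
    _ = parryMeasure β E := hinv.measure_preimage hE.nullMeasurableSet
    _ ≤ C * volume E := h E hE

theorem volume_betaMap_preimage_null {β : ℝ} (hβ : 1 < β) (E : Set unitInterval)
    (hE : volume E = 0) : volume (betaMap β ⁻¹' E) = 0 := by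
  obtain ⟨C, -, h⟩ := exists_volume_iterate_betaMap_preimage_le hβ
  refine measure_mono_null (Set.preimage_mono (subset_toMeasurable volume E)) ?_
  have := h 1 _ (measurableSet_toMeasurable volume E)
  rw [measure_toMeasurable, hE, mul_zero] at this
  simpa using this

/-- The invariant probability measure of the `β`-transformation for a Pisot number `β`. -/
theorem IsPisot.exists_ergodic_betaMap {β : ℝ} (hβ : IsPisot β) :
    ∃ μ : Measure unitInterval, IsProbabilityMeasure μ ∧ Ergodic (betaMap β) μ ∧ volume ≪ μ ∧
      ∃ c : ENNReal, c ≠ ⊤ ∧ μ ≤ c • volume := by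
  obtain ⟨C, hC, hle⟩ := exists_parryMeasure_le hβ.1
  set m := parryMeasure β Set.univ with hm
  have hm1 : 1 ≤ m := by
    simpa using volume_le_parryMeasure β (MeasurableSet.univ (α := unitInterval))
  have hm0 : m ≠ 0 := (zero_lt_one.trans_le hm1).ne'
  have hmt : m ≠ ⊤ := by
    refine ne_top_of_le_ne_top hC ?_
    simpa using hle Set.univ MeasurableSet.univ
  have hbd : m⁻¹ • parryMeasure β ≤ C • volume := by
    refine Measure.le_iff.2 fun E hE => ?_
    rw [Measure.smul_apply, Measure.smul_apply, smul_eq_mul, smul_eq_mul]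
    exact (mul_le_of_le_one_left (zero_le) (ENNReal.inv_le_one.2 hm1)).trans (hle E hE)
  refine ⟨m⁻¹ • parryMeasure β, ⟨?_⟩, ⟨(measurePreserving_parryMeasure hβ.1).smul_measure _,
    hβ.preErgodic_betaMap ?_⟩, ?_, C, hC, hbd⟩
  · rw [Measure.smul_apply, smul_eq_mul, ENNReal.inv_mul_cancel hm0 hmt]
  · exact (Measure.absolutelyContinuous_of_le hbd).trans
      (Measure.AbsolutelyContinuous.rfl.smul_left C)
  · refine Measure.AbsolutelyContinuous.mk fun E hE h0 => ?_
    rw [Measure.smul_apply, smul_eq_mul, mul_eq_zero, ENNReal.inv_eq_zero] at h0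
    exact le_antisymm ((volume_le_parryMeasure β hE).trans_eq (h0.resolve_left hmt)) (zero_le)

section Comparison

variable {β : ℝ} {S : unitInterval → unitInterval} {g : unitInterval → ℕ} {F : Set ℝ} {Q : ℕ}
  {μ ν : Measure unitInterval} [IsProbabilityMeasure μ] [IsProbabilityMeasure ν]
  {c : ENNReal}

/-- A generic point of `S` is generic for the `β`-transformation. -/
theorem mem_dynGenericPoints_betaMap (hβ : 1 < β) (hF : F.Finite) (hg1 : ∀ x, 1 ≤ g x)
    (hgQ : ∀ x, g x ≤ Q)
    (hdiff : ∀ x k, ∃ s d : ℝ, (s = 1 ∨ s = -1) ∧ d ∈ F ∧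
      ((betaMap β)^[birkhoffSum S g k x] x : ℝ) = s * (S^[k] x : ℝ) + d)
    (hμ : Ergodic (betaMap β) μ) (hvolμ : volume ≪ μ) (hc : c ≠ ⊤) (hν : ν ≤ c • volume)
    {x : unitInterval} (hx : x ∈ dynGenericPoints S ν) : x ∈ dynGenericPoints (betaMap β) μ := by
  have hβ0 : 0 ≤ β := zero_le_one.trans hβ.le
  have hcont := ae_continuousAt_betaMap hβ0
  refine mem_dynGenericPoints_of_forall_absolutelyContinuous (measurable_betaMap β) hμ hvolμ
    hcont fun ρ σ hσ hρ => ?_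
  obtain ⟨C, hC, hT⟩ := exists_volume_iterate_betaMap_preimage_le hβ
  have := hF.fintype
  choose s d hs hd hsd using hdiff x
  have hmono := strictMono_birkhoffSum S hg1 x
  -- The time `n` falls in the block of `T`-steps matching the `S`-step number `κ n`; its offset in
  -- the block is less than `Q`.
  choose κ hκ1 hκ2 using hmono.exists_le_lt_succ (birkhoffSum_zero S g x)
  have hj : ∀ n, n - birkhoffSum S g (κ n) x < Q := fun n => by
    have h1 := hκ2 n
    have h2 := hgQ (S^[κ n] x)
    have h3 := hκ1 n
    simp only [birkhoffSum_succ] at h1 h3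
    omega
  -- The label records sign, translation and offset; the offset is what makes `κ` injective on each
  -- label.
  refine absolutelyContinuous_of_relations (ι := ({1, -1} : Set ℝ) × F × Fin Q)
    (ν := ⟨ν, inferInstance⟩) hc hC (fun E => hν E)
    ((mem_dynGenericPoints_iff_tendsto S ⟨ν, inferInstance⟩ x).1 hx)
    (fun r E => affinePreimage r.1 r.2.1 ((betaMap β)^[r.2.2] ⁻¹' E))
    (fun r E hE => volume_frontier_affinePreimage r.1.2 _ (measure_frontier_iterate_preimage hcont
      (volume_betaMap_preimage_null hβ) hE _))
    (fun r E hE => (volume_affinePreimage_le r.1.2 _ _).trans (hT _ E hE))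
    (lab := fun n => (⟨s (κ n), hs (κ n)⟩, ⟨d (κ n), hd (κ n)⟩, ⟨_, hj n⟩)) (κ := κ)
    le_rfl (fun n => ?_) (fun n n' h h' => ?_) (fun n E hE => ?_) hσ hρ
  · rw [one_mul]
    exact (hmono.le_apply (x := κ n)).trans (hκ1 n)
  · simp only [Prod.mk.injEq, Fin.mk.injEq] at h
    have h1 := hκ1 n
    have h2 := hκ1 n'
    have h3 := h.2.2
    rw [h'] at h1 h3
    omega
  · refine ⟨(betaMap β)^[birkhoffSum S g (κ n) x] x, ?_, hsd (κ n)⟩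
    rw [Set.mem_preimage, ← Function.iterate_add_apply, Nat.sub_add_cancel (hκ1 n)]
    exact hE

/-- A generic point of the `β`-transformation is generic for `S`. -/
theorem mem_dynGenericPoints_of_betaMap (hS : Ergodic S ν)
    (hScont : ∀ᵐ y : unitInterval, ContinuousAt S y) (hF : F.Finite) (hg1 : ∀ x, 1 ≤ g x)
    (hQ : 1 ≤ Q) (hgQ : ∀ x, g x ≤ Q)
    (hdiff : ∀ x k, ∃ s d : ℝ, (s = 1 ∨ s = -1) ∧ d ∈ F ∧
      ((betaMap β)^[birkhoffSum S g k x] x : ℝ) = s * (S^[k] x : ℝ) + d)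
    (hvolν : volume ≪ ν) (hc : c ≠ ⊤) (hμ : μ ≤ c • volume)
    {x : unitInterval} (hx : x ∈ dynGenericPoints (betaMap β) μ) : x ∈ dynGenericPoints S ν := by
  refine mem_dynGenericPoints_of_forall_absolutelyContinuous hS.measurable hS hvolν
    hScont fun ρ σ hσ hρ => ?_
  have := hF.fintype
  choose s d hs hd hsd using hdiff x
  refine absolutelyContinuous_of_relations (ι := ({1, -1} : Set ℝ) × F)
    (ν := ⟨μ, inferInstance⟩) hc ENNReal.one_ne_top (fun E => hμ E)
    ((mem_dynGenericPoints_iff_tendsto (betaMap β) ⟨μ, inferInstance⟩ x).1 hx)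
    -- Solving `y = s * u + d` for `u` gives `u = s * y - s * d`, as `s * s = 1`.
    (fun r E => affinePreimage r.1 (-(r.1 * r.2)) E)
    (fun r E hE => volume_frontier_affinePreimage r.1.2 _ hE)
    (fun r E _ => (volume_affinePreimage_le r.1.2 _ _).trans_eq (one_mul _).symm)
    (lab := fun k => (⟨s k, hs k⟩, ⟨d k, hd k⟩)) (κ := fun k => birkhoffSum S g k x)
    hQ (fun k => birkhoffSum_le_mul S hgQ k x)
    (fun k k' _ h => (strictMono_birkhoffSum S hg1 x).injective h) (fun k E hE => ?_) hσ hρ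
  refine ⟨S^[k] x, hE, ?_⟩
  rw [hsd k]
  have hss : s k * s k = 1 := by rcases hs k with h | h <;> rw [h] <;> norm_num
  linear_combination (-(S^[k] x : ℝ)) * hss

end Comparison

theorem theorem3p3 (β : ℝ) (hβ : IsPisot β)
    -- the finite partition of `[0, 1]` into intervals
    (l : ℕ) (J : Fin l → Set unitInterval)
    (hJ_interval : ∀ i, (J i).OrdConnected)
    (hJ_disjoint : Pairwise (fun i j => Disjoint (J i) (J j)))
    (hJ_cover : (⋃ i, J i) = Set.univ)
    -- signs, exponents and intercepts of the branches
    (ε : Fin l → ℝ) (hε : ∀ i, ε i = 1 ∨ ε i = -1)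
    (m : Fin l → ℕ) (hm : ∀ i, 1 ≤ m i)
    (b : Fin l → ℝ) (hb : ∀ i, b i ∈ IntermediateField.adjoin ℚ {β})
    (S : unitInterval → unitInterval)
    (hS : ∀ i, ∀ x ∈ J i, (S x : ℝ) = ε i * β ^ m i * (x : ℝ) + b i)
    -- the ergodic invariant probability measure of `S`, comparable to Lebesgue measure
    (ν : Measure unitInterval) (hν_prob : IsProbabilityMeasure ν) (hν_erg : Ergodic S ν)
    (c : ℝ) (hc : 0 < c)
    (hν_comp : ∀ E : Set unitInterval, MeasurableSet E →
      ENNReal.ofReal c⁻¹ * volume E ≤ ν E ∧ ν E ≤ ENNReal.ofReal c * volume E) :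
    -- `μ` is the unique absolutely continuous invariant probability measure of `x ↦ {β x}`
    ∃ μ : Measure unitInterval,
      (IsProbabilityMeasure μ ∧ Ergodic (betaMap β) μ ∧ μ ≪ volume ∧
        ∀ μ' : Measure unitInterval, IsProbabilityMeasure μ' →
          MeasurePreserving (betaMap β) μ' μ' → μ' ≪ volume → μ' = μ) ∧
      dynGenericPoints (betaMap β) μ = dynGenericPoints S ν := by

  have hβ1 := hβ.1
  obtain ⟨μ, hμ_prob, hμ_erg, hvolμ, c', hc', hμc⟩ := hβ.exists_ergodic_betaMap
  have hνc : ν ≤ ENNReal.ofReal c • volume := Measure.le_iff.2 fun E hE => (hν_comp E hE).2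
  have hvolν : volume ≪ ν := Measure.AbsolutelyContinuous.mk fun E hE h0 => by
    have h := (hν_comp E hE).1
    rw [h0, nonpos_iff_eq_zero, mul_eq_zero, ENNReal.ofReal_eq_zero] at h
    exact h.resolve_left (not_le.2 (inv_pos.2 hc))
  have hidx : ∀ x, ∃ i, x ∈ J i := fun x => Set.mem_iUnion.1 (hJ_cover.symm ▸ Set.mem_univ x)
  choose idx hidx using hidx
  obtain ⟨F, hF, hdiff⟩ := hβ.exists_finite_difference hε hm hb idx fun x => hS _ x (hidx x)
  have hm1 : ∀ x, 1 ≤ (m ∘ idx) x := fun x => hm _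
  -- The added `1` makes the bound on the exponents visibly positive.
  have hmQ : ∀ x, (m ∘ idx) x ≤ (∑ i, m i) + 1 := fun x =>
    (Finset.single_le_sum (fun i _ => Nat.zero_le (m i)) (Finset.mem_univ (idx x))).trans
      (Nat.le_succ _)
  have hμvol : μ ≪ volume := (Measure.absolutelyContinuous_of_le hμc).trans
    (Measure.AbsolutelyContinuous.rfl.smul_left c')
  refine ⟨μ, ⟨hμ_prob, hμ_erg, hμvol, fun μ' hμ' hinv hac =>
    hμ_erg.eq_of_absolutelyContinuous hinv (hac.trans hvolμ)⟩, Set.Subset.antisymm ?_ ?_⟩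
  · intro x hx
    exact mem_dynGenericPoints_of_betaMap hν_erg (ae_continuousAt_of_piecewise_affine hJ_interval
      hJ_cover hS) hF hm1 (Nat.le_add_left 1 _) hmQ hdiff hvolν hc' hμc hx
  · intro x hx
    exact mem_dynGenericPoints_betaMap hβ1 hF hm1 hmQ hdiff hμ_erg hvolμ ENNReal.ofReal_ne_top
      hνc hx
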